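/- For all integers $p\ge 1$ and $d\ge 2$, let $L_1,\dots,L_p$ be i.i.d. random vectors uniformly distributed on the unit sphere $S^{d-1}\subset\mathbb R^d$, and let $Z=Z_d$ be a random vector in $\mathbb R^d$ that is independent of $(L_1,\dots,L_p)$; the law of $Z$ depends only on $d$. (1) Suppose that $Z\sim EC_d(0,I)$, that is, $Z$ has a Lebesgue density on $\mathbb R^d$ proportional to $z\mapsto g_d(\|z\|_2^2)$ for some continuous $g_d:[0,\infty)\to[0,\infty)$ for which this function of $z$ is integrable. Suppose further that $(u_d)$ is a sequence of real constants with $\|Z_d\|_2^2/u_d\to 1$ in probability as $d\to\infty$. Then, as $p\to\infty$ and $d\to\infty$, $$\frac{\max_{1\le j\le p}|\langle L_j,Z\rangle|}{\sqrt{u_d\,(1-p^{-2/(d-1)})}}\longrightarrow 1\quad\text{in probability},$$ that is, for every $\delta>0$, $$\lim_{p,d\to\infty}\mathbb P\left(\left|\frac{\max_{1\le j\le p}|\langle L_j,Z\rangle|}{\sqrt{u_d\,(1-p^{-2/(d-1)})}}-1\right|>\delta\right)=0 ,$$ where the limit is a double limit ($p$ and $d$ tend to infinity jointly, without any restriction on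 their relative rates). (2) If $Z\sim N_d(0,I)$, then in the same sense, as $p\to\infty$ and $d\to\infty$, $$\frac{\max_{1\le j\le p}|\langle L_j,Z\rangle|}{\sqrt{d\,(1-p^{-2/(d-1)})}}\longrightarrow 1\quad\text{in probability}.$$ -/

import Mathlib

open MeasureTheory ProbabilityTheory Filter Topology

noncomputable section

/-- The uniform distribution on the unit sphere `S^{d-1}` of `ℝ^d`, as a measure on `ℝ^d`:
the normalized surface measure. (It is a probability measure for `d ≥ 1`.) -/
def unifSphere (d : ℕ) : Measure (EuclideanSpace ℝ (Fin d)) :=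
  (((volume : Measure (EuclideanSpace ℝ (Fin d))).toSphere Set.univ)⁻¹ •
    (volume : Measure (EuclideanSpace ℝ (Fin d))).toSphere).map Subtype.val

/-- The quadratic form `(v - ξ)ᵀ Θ⁻¹ (v - ξ)`. -/
def ellipticalForm {d : ℕ} (ξ : EuclideanSpace ℝ (Fin d)) (Θ : Matrix (Fin d) (Fin d) ℝ)
    (v : EuclideanSpace ℝ (Fin d)) : ℝ :=
  (v - ξ).ofLp ⬝ᵥ (Θ⁻¹.mulVec (v - ξ).ofLp)

/-- `ν` is an elliptical distribution `EC_d(ξ, Θ)`: a probability measure on `ℝ^d` whose Lebesgue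
density is proportional to `v ↦ g ((v - ξ)ᵀ Θ⁻¹ (v - ξ))` for a continuous `g : [0, ∞) → [0, ∞)`
for which this function of `v` is integrable. -/
def IsElliptical {d : ℕ} (ν : Measure (EuclideanSpace ℝ (Fin d)))
    (ξ : EuclideanSpace ℝ (Fin d)) (Θ : Matrix (Fin d) (Fin d) ℝ) : Prop :=
  IsProbabilityMeasure ν ∧ Θ.PosDef ∧
    ∃ (g : ℝ → ℝ) (c : ℝ), 0 < c ∧ ContinuousOn g (Set.Ici 0) ∧ (∀ t, 0 ≤ t → 0 ≤ g t) ∧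
      Integrable (fun v => g (ellipticalForm ξ Θ v)) volume ∧
      ν = volume.withDensity (fun v => ENNReal.ofReal (c * g (ellipticalForm ξ Θ v)))

/-- Convergence in probability to a constant `c`, along the filter `l`, of real random variables
`X i` each living on its own probability space `(Ω i, P i)`. -/
def TendstoInProb {ι : Type*} {Ω : ι → Type*} [∀ i, MeasurableSpace (Ω i)]
    (P : ∀ i, Measure (Ω i)) (X : ∀ i, Ω i → ℝ) (l : Filter ι) (c : ℝ) : Prop :=
  ∀ δ : ℝ, 0 < δ → Tendsto (fun i => P i {ω | δ < |X i ω - c|}) l (𝓝 0)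

/-- `max_{j} |⟨ℓ_j, z⟩|` (for `p ≥ 1` vectors; the value is `0` for `p = 0`). -/
def maxAbsInner {p d : ℕ} (ℓ : Fin p → EuclideanSpace ℝ (Fin d))
    (z : EuclideanSpace ℝ (Fin d)) : ℝ :=
  ⨆ j, |inner ℝ (ℓ j) z|

/-- The normalization `√(u (1 - p^{-2/(d-1)}))`. -/
def rexBound (u : ℝ) (p d : ℕ) : ℝ :=
  √(u * (1 - (p : ℝ) ^ (-(2 : ℝ) / ((d : ℝ) - 1))))

end

/-!
A uniform point of `S^{d-1}` is the direction of a standard Gaussian vector `x` of `ℝ^d`: the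
Gaussian density is radial, so both laws agree on cones. Split `x = (r, y)` along a fixed `z`, with
`y` standard Gaussian in dimension `n = d - 1`. The double cap of height `s` around `z` becomes
`|r| > k ‖y‖` with `1 + k² = 1 / (1 - s²)`, and integrating the tail bounds
`c_ε exp (-(1 + ε) a² / 2) ≤ ℙ(|r| > a) ≤ 2 exp (-a² / 2)` at `a = k ‖y‖` by means of the Laplace
transform of `‖y‖²` shows that the cap has measure between `c_ε (1 - s²)^{(1 + ε) n / 2}` and
`2 (1 - s²)^{n / 2}`.

At the height given by `1 - s² = p^{-2t/n}` these bounds are `c_ε p^{-(1 + ε) t}` and `2 p^{-t}`,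
free of `d`. With `t = 1 + η` the union bound over the `p` vectors gives
`ℙ(max > s ‖Z‖) ≤ 2 p^{-η}`; with `t = 1 - η` and `ε = η` independence gives
`ℙ(max < s ‖Z‖) ≤ exp (-c_η p^{η²})`. Bernoulli's inequality compares the two values
`1 - a^{1 ± η}` of `s²`, where `a = p^{-2/n}`, with `(1 ± η) (1 - a)`. No error term depends on `d`
except that of `‖Z‖² / u_d → 1`, which does not depend on `p`; hence the limit is a joint one.
-/

section Polar

variable {E : Type*} [NormedAddCommGroup E] [NormedSpace ℝ E] [FiniteDimensional ℝ E]
  [Nontrivial E] [MeasurableSpace E] [BorelSpace E] (μ : Measure E) [μ.IsAddHaarMeasure]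

lemma setLIntegral_fun_norm_of_cone {C : Set E} (hC : MeasurableSet C)
    (hcone : ∀ r : ℝ, 0 < r → ∀ x, r • x ∈ C ↔ x ∈ C) {F : ℝ → ENNReal} (hF : Measurable F) :
    ∫⁻ x in C, F ‖x‖ ∂μ = μ.toSphere (Subtype.val ⁻¹' C) *
      ∫⁻ r : Set.Ioi (0 : ℝ), F r ∂(Measure.volumeIoiPow (Module.finrank ℝ E - 1)) := by
  have hC' : MeasurableSet (Subtype.val ⁻¹' C : Set (Metric.sphere (0 : E) 1)) :=
    measurable_subtype_coe hC
  have hFv : Measurable (fun r : Set.Ioi (0 : ℝ) => F r) := hF.comp measurable_subtype_coe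
  calc ∫⁻ x in C, F ‖x‖ ∂μ
      = ∫⁻ x in ({0}ᶜ : Set E), C.indicator (fun x => F ‖x‖) x ∂μ := by
        rw [restrict_compl_singleton, lintegral_indicator hC]
    _ = ∫⁻ x : ({0}ᶜ : Set E), C.indicator (fun x => F ‖x‖) x.1 ∂(μ.comap (↑)) := by
        rw [lintegral_subtype_comap (measurableSet_singleton _).compl]
    _ = ∫⁻ z, (Subtype.val ⁻¹' C).indicator 1 z.1 * F z.2
          ∂(μ.toSphere.prod (Measure.volumeIoiPow (Module.finrank ℝ E - 1))) := by
        have hprod : Measurable fun z : Metric.sphere (0 : E) 1 × Set.Ioi (0 : ℝ) =>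
            (Subtype.val ⁻¹' C).indicator (1 : Metric.sphere (0 : E) 1 → ENNReal) z.1 * F z.2 :=
          ((measurable_one.indicator hC').comp measurable_fst).mul (hFv.comp measurable_snd)
        rw [← μ.measurePreserving_homeomorphUnitSphereProd.lintegral_comp hprod]
        refine lintegral_congr fun x => ?_
        have hx : 0 < ‖x.1‖ := norm_pos_iff.2 x.2
        have hmem : ‖x.1‖⁻¹ • x.1 ∈ C ↔ x.1 ∈ C := hcone _ (inv_pos.2 hx) _
        by_cases h : x.1 ∈ C <;> simp [Set.indicator, hmem, h]
    _ = _ := by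
        rw [lintegral_prod_mul (measurable_one.indicator hC').aemeasurable hFv.aemeasurable,
          lintegral_indicator_one hC']

lemma withDensity_fun_norm_apply_of_cone {C : Set E} (hC : MeasurableSet C)
    (hcone : ∀ r : ℝ, 0 < r → ∀ x, r • x ∈ C ↔ x ∈ C) {F : ℝ → ENNReal} (hF : Measurable F)
    [IsProbabilityMeasure (μ.withDensity fun x => F ‖x‖)] :
    μ.withDensity (fun x => F ‖x‖) C =
      (μ.toSphere Set.univ)⁻¹ * μ.toSphere (Subtype.val ⁻¹' C) := by
  have htotal : μ.toSphere Set.univ *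
      ∫⁻ r : Set.Ioi (0 : ℝ), F r ∂(Measure.volumeIoiPow (Module.finrank ℝ E - 1)) = 1 := by
    rw [← Set.preimage_univ (f := Subtype.val),
      ← setLIntegral_fun_norm_of_cone μ MeasurableSet.univ (by simp) hF,
      ← withDensity_apply _ MeasurableSet.univ, measure_univ]
  rw [withDensity_apply _ hC, setLIntegral_fun_norm_of_cone μ hC hcone hF, mul_comm,
    ENNReal.eq_inv_of_mul_eq_one_left ((mul_comm _ _).trans htotal)]

end Polar

lemma exists_orthonormalBasis_eq_norm_smul {E : Type*} [NormedAddCommGroup E]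
    [InnerProductSpace ℝ E] [FiniteDimensional ℝ E] {n : ℕ} (hn : Module.finrank ℝ E = n + 1)
    (z : E) :
    ∃ b : OrthonormalBasis (Fin (n + 1)) ℝ E, z = ‖z‖ • b 0 := by
  rcases eq_or_ne z 0 with rfl | hz
  · exact ⟨(stdOrthonormalBasis ℝ E).reindex (finCongr hn), by simp⟩
  · have horth : Orthonormal ℝ (Set.domRestrict {0} fun _ : Fin (n + 1) => ‖z‖⁻¹ • z) :=
      ⟨fun _ => norm_smul_inv_norm hz, fun i j hij => (hij (Subsingleton.elim _ _)).elim⟩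
    obtain ⟨b, hb⟩ := horth.exists_orthonormalBasis_extension_of_card_eq (by simpa using hn)
    exact ⟨b, by rw [hb 0 rfl, smul_inv_smul₀ (norm_ne_zero_iff.2 hz)]⟩

section StdGaussian

open Module Real

variable {E : Type*} [NormedAddCommGroup E] [InnerProductSpace ℝ E] [FiniteDimensional ℝ E]
  [MeasurableSpace E] [BorelSpace E]

lemma lintegral_ofReal_exp_neg_mul_sq_norm {b : ℝ} (hb : 0 < b) :
    ∫⁻ x : E, ENNReal.ofReal (exp (-b * ‖x‖ ^ 2)) =
      ENNReal.ofReal ((π / b) ^ (finrank ℝ E / 2 : ℝ)) := by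
  have h := GaussianFourier.integral_rexp_neg_mul_sq_norm (V := E) hb
  rw [← h, ofReal_integral_eq_lintegral_ofReal _ (.of_forall fun _ => (exp_pos _).le)]
  -- The integral of a non-integrable function would be `0`.
  exact not_not.1 fun hni => (by positivity : (π / b) ^ (finrank ℝ E / 2 : ℝ) ≠ 0)
    (h ▸ integral_undef hni)

lemma stdGaussian_eq_withDensity :
    stdGaussian E = volume.withDensity fun x : E =>
      ENNReal.ofReal ((2 * π) ^ (-(finrank ℝ E / 2 : ℝ)) * exp (-(1 / 2) * ‖x‖ ^ 2)) := by
  have hfin : IsFiniteMeasure (volume.withDensity fun x : E =>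
      ENNReal.ofReal ((2 * π) ^ (-(finrank ℝ E / 2 : ℝ)) * exp (-(1 / 2) * ‖x‖ ^ 2))) := by
    refine isFiniteMeasure_withDensity ?_
    simp_rw [ENNReal.ofReal_mul (show 0 ≤ (2 * π) ^ (-(finrank ℝ E / 2 : ℝ)) by positivity)]
    rw [lintegral_const_mul _ (by fun_prop),
      lintegral_ofReal_exp_neg_mul_sq_norm (by norm_num)]
    exact ENNReal.mul_ne_top ENNReal.ofReal_ne_top ENNReal.ofReal_ne_top
  refine Measure.ext_of_charFun (funext fun t => ?_)
  rw [charFun_stdGaussian, charFun_apply,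
    integral_withDensity_eq_integral_toReal_smul (by fun_prop) (by simp)]
  have hnorm : ((2 * π) ^ (-(finrank ℝ E / 2 : ℝ)) : ℝ) *
      (π / (1 / 2 : ℂ)) ^ (finrank ℝ E / 2 : ℂ) = 1 := by
    rw [show (π / (1 / 2 : ℂ)) = (2 * π : ℝ) by push_cast; ring,
      show (finrank ℝ E / 2 : ℂ) = (finrank ℝ E / 2 : ℝ) by push_cast; rfl,
      ← Complex.ofReal_cpow (by positivity), ← Complex.ofReal_mul,
      ← rpow_add (by positivity), neg_add_cancel, rpow_zero, Complex.ofReal_one]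
  calc Complex.exp (-‖t‖ ^ 2 / 2)
      = ((2 * π) ^ (-(finrank ℝ E / 2 : ℝ)) : ℝ) * ∫ x : E, Complex.exp
          (-(1 / 2) * ‖x‖ ^ 2 + Complex.I * inner ℝ t x) := by
        rw [GaussianFourier.integral_cexp_neg_mul_sq_norm_add (by simp), ← mul_assoc, hnorm,
          one_mul, Complex.I_sq]
        congr 1
        ring
    _ = _ := by
        rw [← integral_const_mul]
        refine integral_congr_ae (.of_forall fun x => ?_)
        beta_reduce
        rw [ENNReal.toReal_ofReal (by positivity), Complex.real_smul, Complex.ofReal_mul, mul_assoc,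
          Complex.ofReal_exp, ← Complex.exp_add, real_inner_comm, mul_comm Complex.I]
        norm_num

lemma lintegral_exp_neg_mul_sq_norm_stdGaussian {b : ℝ} (hb : -1 < b) :
    ∫⁻ x, ENNReal.ofReal (exp (-b * ‖x‖ ^ 2 / 2)) ∂(stdGaussian E) =
      ENNReal.ofReal ((1 + b) ^ (-(finrank ℝ E / 2 : ℝ))) := by
  have hb' : 0 < (1 + b) / 2 := by linarith
  calc ∫⁻ x, ENNReal.ofReal (exp (-b * ‖x‖ ^ 2 / 2)) ∂(stdGaussian E)
      = ENNReal.ofReal ((2 * π) ^ (-(finrank ℝ E / 2 : ℝ))) *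
          ∫⁻ x : E, ENNReal.ofReal (exp (-((1 + b) / 2) * ‖x‖ ^ 2)) := by
        rw [stdGaussian_eq_withDensity, lintegral_withDensity_eq_lintegral_mul _ (by fun_prop)
          (by fun_prop), ← lintegral_const_mul _ (by fun_prop)]
        refine lintegral_congr fun x => ?_
        rw [Pi.mul_apply, ← ENNReal.ofReal_mul (by positivity),
          ← ENNReal.ofReal_mul (by positivity), mul_assoc, ← exp_add]
        ring_nf
    _ = _ := by
        rw [lintegral_ofReal_exp_neg_mul_sq_norm hb', ← ENNReal.ofReal_mul (by positivity),
          show π / ((1 + b) / 2) = (2 * π) * (1 + b)⁻¹ by field_simp,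
          mul_rpow (by positivity) (inv_nonneg.2 (by linarith)), ← mul_assoc,
          ← rpow_add (by positivity), neg_add_cancel, rpow_zero, one_mul,
          inv_rpow (by linarith), ← rpow_neg (by linarith)]

lemma measurePreserving_toLp_stdGaussian (ι : Type*) [Fintype ι] :
    MeasurePreserving (MeasurableEquiv.toLp 2 (ι → ℝ)) (Measure.pi fun _ => gaussianReal 0 1)
      (stdGaussian (EuclideanSpace ℝ ι)) :=
  ⟨by fun_prop, map_pi_eq_stdGaussian⟩

lemma exists_measurePreserving_stdGaussian_prod {n : ℕ} (hn : finrank ℝ E = n + 1) (z : E) :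
    ∃ e : E → ℝ × EuclideanSpace ℝ (Fin n),
      MeasurePreserving e (stdGaussian E)
        ((gaussianReal 0 1).prod (stdGaussian (EuclideanSpace ℝ (Fin n)))) ∧
      (∀ x, inner ℝ x z = ‖z‖ * (e x).1) ∧ ∀ x, ‖x‖ ^ 2 = (e x).1 ^ 2 + ‖(e x).2‖ ^ 2 := by
  obtain ⟨b, hb⟩ := exists_orthonormalBasis_eq_norm_smul hn z
  refine ⟨fun x => (b.repr x 0, WithLp.toLp 2 fun i => b.repr x i.succ), ?_, fun x => ?_,
    fun x => ?_⟩
  · have hrepr : MeasurePreserving b.repr (stdGaussian E) (stdGaussian _) :=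
      ⟨by fun_prop, stdGaussian_map b.repr⟩
    exact ((MeasurePreserving.id _).prod (measurePreserving_toLp_stdGaussian (Fin n))).comp
      ((measurePreserving_piFinSuccAbove (fun _ => gaussianReal 0 1) 0).comp
        ((measurePreserving_toLp_stdGaussian (Fin (n + 1))).symm.comp hrepr))
  · nth_rw 1 [hb]
    rw [real_inner_smul_right, real_inner_comm, ← b.repr_apply_apply]
  · rw [← b.repr.norm_map x, EuclideanSpace.real_norm_sq_eq, EuclideanSpace.real_norm_sq_eq,
      Fin.sum_univ_succ]

end StdGaussian

section UnifSphere

variable {d : ℕ}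

lemma isProbabilityMeasure_unifSphere (hd : 1 ≤ d) : IsProbabilityMeasure (unifSphere d) := by
  have : Nonempty (Fin d) := ⟨⟨0, hd⟩⟩
  refine ⟨?_⟩
  rw [unifSphere, Measure.map_apply measurable_subtype_coe .univ, Set.preimage_univ,
    Measure.smul_apply, smul_eq_mul, ENNReal.inv_mul_cancel
      (Measure.measure_univ_ne_zero.2 (Measure.toSphere_ne_zero _)) (measure_ne_top _ _)]

lemma ae_norm_eq_one_unifSphere (d : ℕ) : ∀ᵐ x ∂(unifSphere d), ‖x‖ = 1 := by
  rw [unifSphere, ae_map_iff measurable_subtype_coe.aemeasurable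
    (measurableSet_eq_fun measurable_norm measurable_const)]
  exact .of_forall fun x => by simp

lemma unifSphere_eq_stdGaussian_of_cone (hd : 1 ≤ d) {C : Set (EuclideanSpace ℝ (Fin d))}
    (hC : MeasurableSet C) (hcone : ∀ r : ℝ, 0 < r → ∀ x, r • x ∈ C ↔ x ∈ C) :
    unifSphere d C = stdGaussian (EuclideanSpace ℝ (Fin d)) C := by
  have : Nonempty (Fin d) := ⟨⟨0, hd⟩⟩
  let F : ℝ → ENNReal := fun r => ENNReal.ofReal
    ((2 * Real.pi) ^ (-(Module.finrank ℝ (EuclideanSpace ℝ (Fin d)) / 2 : ℝ)) *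
      Real.exp (-(1 / 2) * r ^ 2))
  have hdensity : stdGaussian (EuclideanSpace ℝ (Fin d)) = volume.withDensity fun x => F ‖x‖ :=
    stdGaussian_eq_withDensity
  have : IsProbabilityMeasure (volume.withDensity fun x : EuclideanSpace ℝ (Fin d) => F ‖x‖) :=
    hdensity ▸ inferInstance
  rw [hdensity, withDensity_fun_norm_apply_of_cone volume hC hcone (by fun_prop), unifSphere,
    Measure.map_apply measurable_subtype_coe hC, Measure.smul_apply, smul_eq_mul]

end UnifSphere

section Tail

open Real

lemma gaussianReal_lt_abs_le {a : ℝ} (ha : 0 ≤ a) :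
    gaussianReal 0 1 {r | a < |r|} ≤ ENNReal.ofReal (2 * exp (-a ^ 2 / 2)) := by
  have hsubG : HasSubgaussianMGF id 1 (gaussianReal 0 1) :=
    ⟨integrable_exp_mul_gaussianReal, fun t => by simp [mgf_id_gaussianReal]⟩
  have hsubset : {r : ℝ | a < |r|} ⊆ {r | a ≤ id r} ∪ {r | a ≤ (-id) r} := fun r hr =>
    le_abs.1 (show a < |r| from hr).le
  rw [ENNReal.le_ofReal_iff_toReal_le (measure_ne_top _ _) (by positivity)]
  calc (gaussianReal 0 1).real {r | a < |r|}
      ≤ (gaussianReal 0 1).real {r | a ≤ id r} + (gaussianReal 0 1).real {r | a ≤ (-id) r} :=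
        (measureReal_mono hsubset).trans (measureReal_union_le _ _)
    _ ≤ exp (-a ^ 2 / 2) + exp (-a ^ 2 / 2) := by
        gcongr
        · simpa using hsubG.measure_ge_le ha
        · simpa using hsubG.neg.measure_ge_le ha
    _ = 2 * exp (-a ^ 2 / 2) := (two_mul _).symm

/-- The constant `c` in the lower bound `c * exp (-(1 + ε) * a ^ 2 / 2)` for the two-sided standard
Gaussian tail beyond `a`. The loss `ε` in the exponent makes `c` independent of `a`. -/
noncomputable def gaussianTailConst (ε : ℝ) : ℝ := exp (-(1 + 1 / ε) / 2) / √(2 * π)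

lemma gaussianTailConst_pos (ε : ℝ) : 0 < gaussianTailConst ε := by
  unfold gaussianTailConst
  positivity

lemma add_one_sq_le {ε : ℝ} (hε : 0 < ε) (a : ℝ) :
    (a + 1) ^ 2 ≤ (1 + ε) * a ^ 2 + (1 + 1 / ε) := by
  have h : (1 + ε) * a ^ 2 + (1 + 1 / ε) - (a + 1) ^ 2 = (ε * a - 1) ^ 2 / ε := by
    field_simp
    ring
  have : 0 ≤ (ε * a - 1) ^ 2 / ε := by positivity
  linarith

lemma gaussianTailConst_mul_exp_le_gaussianReal_lt_abs {a ε : ℝ} (ha : 0 ≤ a) (hε : 0 < ε) :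
    ENNReal.ofReal (gaussianTailConst ε * exp (-((1 + ε) * a ^ 2) / 2)) ≤
      gaussianReal 0 1 {r | a < |r|} := by
  have hpdf : ∀ r ∈ Set.Ioo a (a + 1),
      gaussianTailConst ε * exp (-((1 + ε) * a ^ 2) / 2) ≤ gaussianPDFReal 0 1 r := fun r hr => by
    have hsq : r ^ 2 ≤ (a + 1) ^ 2 := pow_le_pow_left₀ (ha.trans hr.1.le) hr.2.le 2
    rw [gaussianPDFReal, gaussianTailConst, div_mul_eq_mul_div, ← exp_add, div_eq_inv_mul]
    simp only [NNReal.coe_one, mul_one, sub_zero]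
    gcongr
    linarith [add_one_sq_le hε a]
  calc ENNReal.ofReal (gaussianTailConst ε * exp (-((1 + ε) * a ^ 2) / 2))
      = ∫⁻ _ in Set.Ioo a (a + 1),
          ENNReal.ofReal (gaussianTailConst ε * exp (-((1 + ε) * a ^ 2) / 2)) := by
        simp [volume_Ioo]
    _ ≤ ∫⁻ r in Set.Ioo a (a + 1), gaussianPDF 0 1 r :=
        setLIntegral_mono' measurableSet_Ioo fun r hr => ENNReal.ofReal_le_ofReal (hpdf r hr)
    _ = gaussianReal 0 1 (Set.Ioo a (a + 1)) := (gaussianReal_apply 0 one_ne_zero _).symm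
    _ ≤ gaussianReal 0 1 {r | a < |r|} :=
        measure_mono fun r hr => hr.1.trans_le (le_abs_self r)

end Tail

/-- The double spherical cap of height `s` around the direction of `z`. The height is measured
relative to `‖z‖`, so that a random, unnormalized `z` can be plugged in, and the set is not
intersected with the unit sphere, the measures of interest being carried by the sphere. -/
def doubleCap {E : Type*} [NormedAddCommGroup E] [InnerProductSpace ℝ E] (s : ℝ) (z : E) : Set E :=
  {x | s * ‖z‖ < |inner ℝ x z|}

section DoubleCap

open Real

variable {n : ℕ} {s : ℝ} {z : EuclideanSpace ℝ (Fin (n + 1))}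

lemma measurableSet_doubleCap (s : ℝ) (z : EuclideanSpace ℝ (Fin n)) :
    MeasurableSet (doubleCap s z) :=
  measurableSet_lt (by fun_prop) (by fun_prop)

lemma unifSphere_doubleCap (hs0 : 0 ≤ s) (hs1 : s < 1) (hz : z ≠ 0) :
    unifSphere (n + 1) (doubleCap s z) =
      ∫⁻ y, gaussianReal 0 1 {r | s / √(1 - s ^ 2) * ‖y‖ < |r|}
        ∂(stdGaussian (EuclideanSpace ℝ (Fin n))) := by
  have hq : 0 < 1 - s ^ 2 := by nlinarith
  have hz' : 0 < ‖z‖ := norm_pos_iff.2 hz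
  let C : Set (EuclideanSpace ℝ (Fin (n + 1))) := {x | s * ‖x‖ * ‖z‖ < |inner ℝ x z|}
  have hC : MeasurableSet C := measurableSet_lt (by fun_prop) (by fun_prop)
  have hcone : ∀ r : ℝ, 0 < r → ∀ x, r • x ∈ C ↔ x ∈ C := fun r hr x => by
    simp only [C, Set.mem_ofPred_eq, norm_smul, real_inner_smul_left, abs_mul,
      norm_eq_abs, abs_of_pos hr, mul_assoc, mul_left_comm s r]
    exact mul_lt_mul_iff_right₀ hr
  have hcap : unifSphere (n + 1) (doubleCap s z) = unifSphere (n + 1) C := by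
    refine measure_congr ?_
    filter_upwards [ae_norm_eq_one_unifSphere (n + 1)] with x hx
    simp only [eq_iff_iff]
    change s * ‖z‖ < _ ↔ s * ‖x‖ * ‖z‖ < _
    rw [hx, mul_one]
  obtain ⟨e, he, he_inner, he_norm⟩ :=
    exists_measurePreserving_stdGaussian_prod (finrank_euclideanSpace_fin (𝕜 := ℝ)) z
  let S : Set (ℝ × EuclideanSpace ℝ (Fin n)) := {w | s / √(1 - s ^ 2) * ‖w.2‖ < |w.1|}
  have hS : MeasurableSet S := measurableSet_lt (by fun_prop) (by fun_prop)
  have hCS : C = e ⁻¹' S := by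
    ext x
    simp only [C, S, Set.mem_ofPred_eq, Set.mem_preimage]
    rw [he_inner, abs_mul, abs_norm, mul_comm, mul_lt_mul_iff_right₀ hz',
      ← abs_of_nonneg (a := s * ‖x‖) (by positivity),
      ← abs_of_nonneg (a := s / √(1 - s ^ 2) * ‖(e x).2‖) (by positivity),
      ← sq_lt_sq, ← sq_lt_sq, mul_pow, mul_pow, div_pow, sq_sqrt hq.le, he_norm,
      div_mul_eq_mul_div, div_lt_iff₀ hq]
    constructor <;> intro h <;> linarith
  rw [hcap, unifSphere_eq_stdGaussian_of_cone (Nat.le_add_left 1 n) hC hcone, hCS,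
    he.measure_preimage hS.nullMeasurableSet, Measure.prod_apply_symm hS]
  rfl

lemma one_add_div_sqrt_one_sub_sq_sq (hs : s ^ 2 < 1) :
    1 + (s / √(1 - s ^ 2)) ^ 2 = (1 - s ^ 2)⁻¹ := by
  have hq : 0 < 1 - s ^ 2 := sub_pos.2 hs
  rw [div_pow, sq_sqrt hq.le]
  field_simp
  ring

lemma unifSphere_doubleCap_le (hs0 : 0 ≤ s) (hs1 : s < 1) :
    unifSphere (n + 1) (doubleCap s z) ≤ ENNReal.ofReal (2 * (1 - s ^ 2) ^ (n / 2 : ℝ)) := by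
  rcases eq_or_ne z 0 with rfl | hz
  · simp [doubleCap]
  have hq : 0 < 1 - s ^ 2 := by nlinarith
  let k := s / √(1 - s ^ 2)
  calc unifSphere (n + 1) (doubleCap s z)
      = ∫⁻ y, gaussianReal 0 1 {r | k * ‖y‖ < |r|} ∂(stdGaussian (EuclideanSpace ℝ (Fin n))) :=
        unifSphere_doubleCap hs0 hs1 hz
    _ ≤ ∫⁻ y, ENNReal.ofReal 2 * ENNReal.ofReal (exp (-k ^ 2 * ‖y‖ ^ 2 / 2))
          ∂(stdGaussian (EuclideanSpace ℝ (Fin n))) := by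
        refine lintegral_mono fun y => (gaussianReal_lt_abs_le (by positivity)).trans_eq ?_
        rw [ENNReal.ofReal_mul zero_le_two, mul_pow, neg_mul]
    _ = ENNReal.ofReal (2 * (1 + k ^ 2) ^ (-(n / 2 : ℝ))) := by
        rw [lintegral_const_mul _ (by fun_prop),
          lintegral_exp_neg_mul_sq_norm_stdGaussian (by nlinarith [sq_nonneg k]),
          finrank_euclideanSpace_fin, ENNReal.ofReal_mul zero_le_two]
    _ = ENNReal.ofReal (2 * (1 - s ^ 2) ^ (n / 2 : ℝ)) := by
        rw [one_add_div_sqrt_one_sub_sq_sq (by linarith), rpow_neg (by positivity),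
          inv_rpow hq.le, inv_inv]

lemma le_unifSphere_doubleCap {ε : ℝ} (hε : 0 < ε) (hs0 : 0 ≤ s) (hs1 : s < 1) (hz : z ≠ 0) :
    ENNReal.ofReal (gaussianTailConst ε * (1 - s ^ 2) ^ ((1 + ε) * (n / 2 : ℝ))) ≤
      unifSphere (n + 1) (doubleCap s z) := by
  have hq : 0 < 1 - s ^ 2 := by nlinarith
  let k := s / √(1 - s ^ 2)
  have hc := (gaussianTailConst_pos ε).le
  have hbernoulli : 1 + (1 + ε) * k ^ 2 ≤ (1 + k ^ 2) ^ (1 + ε) :=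
    one_add_mul_self_le_rpow_one_add (by nlinarith [sq_nonneg k]) (by linarith)
  calc ENNReal.ofReal (gaussianTailConst ε * (1 - s ^ 2) ^ ((1 + ε) * (n / 2 : ℝ)))
      = ENNReal.ofReal (gaussianTailConst ε * ((1 + k ^ 2) ^ (1 + ε)) ^ (-(n / 2 : ℝ))) := by
        rw [one_add_div_sqrt_one_sub_sq_sq (by linarith), ← rpow_mul (by positivity), mul_neg,
          rpow_neg (by positivity), inv_rpow hq.le, inv_inv]
    _ ≤ ENNReal.ofReal (gaussianTailConst ε * (1 + (1 + ε) * k ^ 2) ^ (-(n / 2 : ℝ))) := by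
        refine ENNReal.ofReal_le_ofReal (mul_le_mul_of_nonneg_left ?_ hc)
        exact rpow_le_rpow_of_nonpos (by positivity) hbernoulli (neg_nonpos.2 (by positivity))
    _ = ∫⁻ y, ENNReal.ofReal (gaussianTailConst ε) *
          ENNReal.ofReal (exp (-((1 + ε) * k ^ 2) * ‖y‖ ^ 2 / 2))
          ∂(stdGaussian (EuclideanSpace ℝ (Fin n))) := by
        rw [lintegral_const_mul _ (by fun_prop),
          lintegral_exp_neg_mul_sq_norm_stdGaussian (by nlinarith [sq_nonneg k]),
          finrank_euclideanSpace_fin, ENNReal.ofReal_mul hc]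
    _ ≤ ∫⁻ y, gaussianReal 0 1 {r | k * ‖y‖ < |r|} ∂(stdGaussian (EuclideanSpace ℝ (Fin n))) := by
        refine lintegral_mono fun y => le_trans (le_of_eq ?_)
          (gaussianTailConst_mul_exp_le_gaussianReal_lt_abs (by positivity) hε)
        rw [ENNReal.ofReal_mul hc, mul_pow, neg_mul, mul_assoc]
    _ = unifSphere (n + 1) (doubleCap s z) := (unifSphere_doubleCap hs0 hs1 hz).symm

lemma sq_sqrt_one_sub_rpow {a t : ℝ} (ha0 : 0 ≤ a) (ha1 : a ≤ 1) (ht : 0 ≤ t) :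
    √(1 - a ^ t) ^ 2 = 1 - a ^ t :=
  sq_sqrt (sub_nonneg.2 (rpow_le_one ha0 ha1 ht))

lemma sqrt_one_sub_rpow_lt_one {a : ℝ} (ha : 0 < a) (t : ℝ) : √(1 - a ^ t) < 1 := by
  rw [sqrt_lt' one_pos, one_pow]
  exact sub_lt_self 1 (rpow_pos_of_pos ha t)

lemma rpow_neg_two_div_le_one {p : ℝ} (hp : 1 ≤ p) (n : ℕ) : p ^ (-2 / n : ℝ) ≤ 1 :=
  rpow_le_one_of_one_le_of_nonpos hp (div_nonpos_of_nonpos_of_nonneg (by norm_num) n.cast_nonneg)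

lemma one_sub_sq_sqrt_rpow {p t : ℝ} (hn : n ≠ 0) (hp : 1 ≤ p) (ht : 0 ≤ t) (r : ℝ) :
    (1 - √(1 - (p ^ (-2 / n : ℝ)) ^ t) ^ 2) ^ (r * (n / 2)) = p ^ (-(r * t)) := by
  have hn' : (n : ℝ) ≠ 0 := Nat.cast_ne_zero.2 hn
  have hp0 : 0 ≤ p := by linarith
  rw [sq_sqrt_one_sub_rpow (by positivity) (rpow_neg_two_div_le_one hp n) ht, sub_sub_cancel,
    ← rpow_mul hp0, ← rpow_mul hp0]
  congr 1
  field_simp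

lemma unifSphere_doubleCap_sqrt_le {p t : ℝ} (hn : n ≠ 0) (hp : 1 ≤ p) (ht : 0 ≤ t) :
    unifSphere (n + 1) (doubleCap √(1 - (p ^ (-2 / n : ℝ)) ^ t) z) ≤
      ENNReal.ofReal (2 * p ^ (-t)) := by
  have h := one_sub_sq_sqrt_rpow hn hp ht 1
  rw [one_mul, one_mul] at h
  exact h ▸ unifSphere_doubleCap_le (sqrt_nonneg _) (sqrt_one_sub_rpow_lt_one (by positivity) t)

lemma le_unifSphere_doubleCap_sqrt {p t ε : ℝ} (hn : n ≠ 0) (hp : 1 ≤ p) (ht : 0 ≤ t)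
    (hε : 0 < ε) (hz : z ≠ 0) :
    ENNReal.ofReal (gaussianTailConst ε * p ^ (-((1 + ε) * t))) ≤
      unifSphere (n + 1) (doubleCap √(1 - (p ^ (-2 / n : ℝ)) ^ t) z) :=
  one_sub_sq_sqrt_rpow hn hp ht (1 + ε) ▸
    le_unifSphere_doubleCap hε (sqrt_nonneg _) (sqrt_one_sub_rpow_lt_one (by positivity) t) hz

end DoubleCap

section Independence

variable {Ω α β ι : Type*} [MeasurableSpace Ω] [MeasurableSpace α] [MeasurableSpace β] [Fintype ι]
  {P : Measure Ω} [IsProbabilityMeasure P] {μ : Measure α} {Y : Ω → β} {B : Set (α × β)}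
  {c : ENNReal}

lemma measure_prodMk_mem_le [SFinite μ] {X : Ω → α} (hX : HasLaw X μ P) (hY : AEMeasurable Y P)
    (hXY : IndepFun X Y P) (hB : MeasurableSet B) (hc : ∀ y, μ {x | (x, y) ∈ B} ≤ c) :
    P {ω | (X ω, Y ω) ∈ B} ≤ c := by
  have : IsProbabilityMeasure (P.map Y) := Measure.isProbabilityMeasure_map hY
  have hlaw : HasLaw (fun ω => (X ω, Y ω)) (μ.prod (P.map Y)) P :=
    IndepFun.hasLaw_prod hX ⟨hY, rfl⟩ hXY
  calc P {ω | (X ω, Y ω) ∈ B} = (μ.prod (P.map Y)) B := hlaw.measure_eq (p := (· ∈ B)) hB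
    _ = ∫⁻ y, μ {x | (x, y) ∈ B} ∂(P.map Y) := Measure.prod_apply_symm hB
    _ ≤ ∫⁻ _, c ∂(P.map Y) := lintegral_mono hc
    _ = c := by simp

variable {X : ι → Ω → α}

lemma measure_exists_prodMk_mem_le [SFinite μ] (hX : ∀ i, HasLaw (X i) μ P)
    (hY : AEMeasurable Y P) (hXY : ∀ i, IndepFun (X i) Y P) (hB : MeasurableSet B)
    (hc : ∀ y, μ {x | (x, y) ∈ B} ≤ c) :
    P {ω | ∃ i, (X i ω, Y ω) ∈ B} ≤ Fintype.card ι * c :=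
  calc P {ω | ∃ i, (X i ω, Y ω) ∈ B} = P (⋃ i, {ω | (X i ω, Y ω) ∈ B}) := by
        rw [Set.ofPred_exists]
    _ ≤ ∑ i, P {ω | (X i ω, Y ω) ∈ B} := measure_iUnion_fintype_le _ _
    _ ≤ ∑ _ : ι, c := Finset.sum_le_sum fun i _ => measure_prodMk_mem_le (hX i) hY (hXY i) hB hc
    _ = Fintype.card ι * c := by simp

lemma measure_forall_prodMk_mem_le [SigmaFinite μ] (hX : ∀ i, HasLaw (X i) μ P)
    (hX_indep : iIndepFun X P) (hY : AEMeasurable Y P) (hXY : IndepFun (fun ω i => X i ω) Y P)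
    (hB : MeasurableSet B) (hc : ∀ y, μ {x | (x, y) ∈ B} ≤ c) :
    P {ω | ∀ i, (X i ω, Y ω) ∈ B} ≤ c ^ Fintype.card ι := by
  have hB' : MeasurableSet {w : (ι → α) × β | ∀ i, (w.1 i, w.2) ∈ B} := by
    rw [Set.ofPred_forall]
    exact .iInter fun i => hB.preimage (by fun_prop)
  refine measure_prodMk_mem_le (iIndepFun.hasLaw_pi hX hX_indep) hY hXY hB' fun y => ?_
  calc Measure.pi (fun _ => μ) {x : ι → α | ∀ i, (x i, y) ∈ B}
      = Measure.pi (fun _ => μ) (Set.univ.pi fun _ => {x | (x, y) ∈ B}) := by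
        congr 1; ext; simp
    _ = μ {x | (x, y) ∈ B} ^ Fintype.card ι := by simp [Measure.pi_pi]
    _ ≤ c ^ Fintype.card ι := pow_le_pow_left' (hc y) _

end Independence

section MaxAbsInner

variable {Ω : Type*} [MeasurableSpace Ω] {P : Measure Ω} [IsProbabilityMeasure P] {p d : ℕ}
  {L : Fin p → Ω → EuclideanSpace ℝ (Fin d)} {Z : Ω → EuclideanSpace ℝ (Fin d)} {s : ℝ}

lemma exists_mem_doubleCap_of_lt_maxAbsInner {ℓ : Fin p → EuclideanSpace ℝ (Fin d)}
    {z : EuclideanSpace ℝ (Fin d)} (hs : 0 ≤ s) (h : s * ‖z‖ < maxAbsInner ℓ z) :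
    ∃ j, ℓ j ∈ doubleCap s z := by
  by_contra! hle
  exact h.not_ge (Real.iSup_le (fun j => not_lt.1 (hle j)) (by positivity))

lemma abs_inner_le_maxAbsInner (ℓ : Fin p → EuclideanSpace ℝ (Fin d))
    (z : EuclideanSpace ℝ (Fin d)) (j : Fin p) : |inner ℝ (ℓ j) z| ≤ maxAbsInner ℓ z :=
  le_ciSup (f := fun j => |inner ℝ (ℓ j) z|) (Set.finite_range _).bddAbove j

lemma measure_lt_maxAbsInner_le {c : ENNReal} (hd : 1 ≤ d)
    (hL : ∀ j, HasLaw (L j) (unifSphere d) P) (hZ : AEMeasurable Z P)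
    (hLZ : ∀ j, IndepFun (L j) Z P) (hs : 0 ≤ s) (hcap : ∀ z, unifSphere d (doubleCap s z) ≤ c) :
    P {ω | s * ‖Z ω‖ < maxAbsInner (fun j => L j ω) (Z ω)} ≤ p * c := by
  have := isProbabilityMeasure_unifSphere hd
  have hB : MeasurableSet {w : EuclideanSpace ℝ (Fin d) × EuclideanSpace ℝ (Fin d) |
      w.1 ∈ doubleCap s w.2} :=
    measurableSet_lt (measurable_snd.norm.const_mul s) (measurable_fst.inner measurable_snd).abs
  calc P {ω | s * ‖Z ω‖ < maxAbsInner (fun j => L j ω) (Z ω)}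
      ≤ P {ω | ∃ j, L j ω ∈ doubleCap s (Z ω)} :=
        measure_mono fun ω hω => exists_mem_doubleCap_of_lt_maxAbsInner hs hω
    _ ≤ Fintype.card (Fin p) * c := measure_exists_prodMk_mem_le hL hZ hLZ hB hcap
    _ = p * c := by rw [Fintype.card_fin]

lemma unifSphere_abs_inner_lt_le {q : ℝ} (hd : 1 ≤ d) (hq : 0 ≤ q)
    (hcap : ∀ z, z ≠ 0 → ENNReal.ofReal q ≤ unifSphere d (doubleCap s z))
    (z : EuclideanSpace ℝ (Fin d)) :
    unifSphere d {x | |inner ℝ x z| < s * ‖z‖} ≤ ENNReal.ofReal (Real.exp (-q)) := by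
  have := isProbabilityMeasure_unifSphere hd
  rcases eq_or_ne z 0 with rfl | hz
  · simp
  calc unifSphere d {x | |inner ℝ x z| < s * ‖z‖}
      ≤ unifSphere d (doubleCap s z)ᶜ := measure_mono fun x hx => not_lt_of_gt (Set.mem_ofPred.1 hx)
    _ = 1 - unifSphere d (doubleCap s z) := prob_compl_eq_one_sub (measurableSet_doubleCap s z)
    _ ≤ ENNReal.ofReal (1 - q) := by
        rw [ENNReal.ofReal_sub _ hq, ENNReal.ofReal_one]
        exact tsub_le_tsub_left (hcap z hz) 1
    _ ≤ ENNReal.ofReal (Real.exp (-q)) := ENNReal.ofReal_le_ofReal (Real.one_sub_le_exp_neg q)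

lemma measure_maxAbsInner_lt_le {q : ℝ} (hd : 1 ≤ d) (hL : ∀ j, HasLaw (L j) (unifSphere d) P)
    (hL_indep : iIndepFun L P) (hZ : AEMeasurable Z P)
    (hLZ : IndepFun (fun ω j => L j ω) Z P) (hq : 0 ≤ q)
    (hcap : ∀ z, z ≠ 0 → ENNReal.ofReal q ≤ unifSphere d (doubleCap s z)) :
    P {ω | maxAbsInner (fun j => L j ω) (Z ω) < s * ‖Z ω‖} ≤
      ENNReal.ofReal (Real.exp (-(p * q))) := by
  have := isProbabilityMeasure_unifSphere hd
  have hB : MeasurableSet {w : EuclideanSpace ℝ (Fin d) × EuclideanSpace ℝ (Fin d) |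
      |inner ℝ w.1 w.2| < s * ‖w.2‖} := measurableSet_lt (by fun_prop) (by fun_prop)
  calc P {ω | maxAbsInner (fun j => L j ω) (Z ω) < s * ‖Z ω‖}
      ≤ P {ω | ∀ j, |inner ℝ (L j ω) (Z ω)| < s * ‖Z ω‖} :=
        measure_mono fun ω hω j => (abs_inner_le_maxAbsInner (fun j => L j ω) (Z ω) j).trans_lt hω
    _ ≤ ENNReal.ofReal (Real.exp (-q)) ^ Fintype.card (Fin p) :=
        measure_forall_prodMk_mem_le hL hL_indep hZ hLZ hB
          (unifSphere_abs_inner_lt_le hd hq hcap)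
    _ = ENNReal.ofReal (Real.exp (-(p * q))) := by
        rw [Fintype.card_fin, ← ENNReal.ofReal_pow (Real.exp_pos _).le, ← Real.exp_nat_mul, mul_neg]

end MaxAbsInner

section Comparison

open Real

lemma one_sub_rpow_one_add_le {a η : ℝ} (ha : 0 ≤ a) (hη : 0 ≤ η) :
    1 - a ^ (1 + η) ≤ (1 + η) * (1 - a) := by
  have h := one_add_mul_self_le_rpow_one_add (s := a - 1) (p := 1 + η) (by linarith) (by linarith)
  rw [add_sub_cancel] at h
  linarith

lemma mul_one_sub_le_one_sub_rpow_one_sub {a η : ℝ} (ha : 0 ≤ a) (hη : 0 ≤ η) (hη1 : η ≤ 1) :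
    (1 - η) * (1 - a) ≤ 1 - a ^ (1 - η) := by
  have h := rpow_one_add_le_one_add_mul_self (s := a - 1) (p := 1 - η) (by linarith) (by linarith)
    (by linarith)
  rw [add_sub_cancel] at h
  linarith

lemma sqrt_mul_mul_sqrt_mul {t u : ℝ} (ht : 0 ≤ t) (hu : 0 ≤ u) (b : ℝ) :
    √(t * b) * √(t * u) = t * √(u * b) := by
  rw [sqrt_mul ht, sqrt_mul ht, sqrt_mul hu, mul_mul_mul_comm, mul_self_sqrt ht, mul_comm √u]

lemma abs_div_sqrt_sub_one_le {M N u b η : ℝ} (hN : 0 ≤ N) (hu : 0 < u) (hb : 0 < b)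
    (hη1 : η ≤ 1) (hNu : |N ^ 2 / u - 1| ≤ η) (hup : M ≤ √((1 + η) * b) * N)
    (hlo : √((1 - η) * b) * N ≤ M) : |M / √(u * b) - 1| ≤ η := by
  have hη : 0 ≤ η := (abs_nonneg _).trans hNu
  obtain ⟨hNu_lo, hNu_up⟩ := abs_le.1 hNu
  have hR : 0 < √(u * b) := sqrt_pos.2 (by positivity)
  have hN_up : N ≤ √((1 + η) * u) := le_sqrt_of_sq_le ((div_le_iff₀ hu).1 (by linarith))
  have hN_lo : √((1 - η) * u) ≤ N := sqrt_le_iff.2 ⟨hN, (le_div_iff₀ hu).1 (by linarith)⟩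
  have hM_up : M ≤ (1 + η) * √(u * b) := by
    rw [← sqrt_mul_mul_sqrt_mul (by linarith) hu.le]
    exact hup.trans (mul_le_mul_of_nonneg_left hN_up (sqrt_nonneg _))
  have hM_lo : (1 - η) * √(u * b) ≤ M := by
    rw [← sqrt_mul_mul_sqrt_mul (by linarith) hu.le]
    exact (mul_le_mul_of_nonneg_left hN_lo (sqrt_nonneg _)).trans hlo
  have hdiv_up := (div_le_iff₀ hR).2 hM_up
  have hdiv_lo := (le_div_iff₀ hR).2 hM_lo
  exact abs_le.2 ⟨by linarith, by linarith⟩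

end Comparison

section Deviation

variable {Ω : Type*} [MeasurableSpace Ω] {P : Measure Ω} [IsProbabilityMeasure P] {p n : ℕ}
  {L : Fin p → Ω → EuclideanSpace ℝ (Fin (n + 1))} {Z : Ω → EuclideanSpace ℝ (Fin (n + 1))}

lemma measure_sqrt_one_sub_rpow_mul_norm_lt_maxAbsInner_le {t : ℝ} (hp : 1 ≤ p) (hn : n ≠ 0)
    (hL : ∀ j, HasLaw (L j) (unifSphere (n + 1)) P) (hZ : AEMeasurable Z P)
    (hLZ : ∀ j, IndepFun (L j) Z P) (ht : 0 ≤ t) :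
    P {ω | √(1 - ((p : ℝ) ^ (-2 / n : ℝ)) ^ t) * ‖Z ω‖ < maxAbsInner (fun j => L j ω) (Z ω)} ≤
      ENNReal.ofReal (2 * (p : ℝ) ^ (1 - t)) := by
  have hp' : (1 : ℝ) ≤ p := by exact_mod_cast hp
  have hp0 : (0 : ℝ) < p := one_pos.trans_le hp'
  refine (measure_lt_maxAbsInner_le (by lia) hL hZ hLZ (Real.sqrt_nonneg _) fun z =>
    unifSphere_doubleCap_sqrt_le hn hp' ht).trans_eq ?_
  rw [← ENNReal.ofReal_natCast, ← ENNReal.ofReal_mul hp0.le, mul_left_comm, sub_eq_add_neg,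
    Real.rpow_add hp0, Real.rpow_one]

lemma measure_maxAbsInner_lt_sqrt_one_sub_rpow_mul_norm_le {t ε : ℝ} (hp : 1 ≤ p) (hn : n ≠ 0)
    (hL : ∀ j, HasLaw (L j) (unifSphere (n + 1)) P) (hL_indep : iIndepFun L P)
    (hZ : AEMeasurable Z P) (hLZ : IndepFun (fun ω j => L j ω) Z P) (ht : 0 ≤ t) (hε : 0 < ε) :
    P {ω | maxAbsInner (fun j => L j ω) (Z ω) < √(1 - ((p : ℝ) ^ (-2 / n : ℝ)) ^ t) * ‖Z ω‖} ≤
      ENNReal.ofReal (Real.exp (-(gaussianTailConst ε * (p : ℝ) ^ (1 - (1 + ε) * t)))) := by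
  have hp' : (1 : ℝ) ≤ p := by exact_mod_cast hp
  have hp0 : (0 : ℝ) < p := one_pos.trans_le hp'
  have hc := (gaussianTailConst_pos ε).le
  refine (measure_maxAbsInner_lt_le (by lia) hL hL_indep hZ hLZ (by positivity) fun z hz =>
    le_unifSphere_doubleCap_sqrt hn hp' ht hε hz).trans_eq ?_
  rw [mul_left_comm, sub_eq_add_neg, Real.rpow_add hp0, Real.rpow_one]

lemma measure_lt_abs_maxAbsInner_div_rexBound_sub_one_le {u η : ℝ} (hp : 2 ≤ p) (hn : n ≠ 0)
    (hL : ∀ j, HasLaw (L j) (unifSphere (n + 1)) P) (hL_indep : iIndepFun L P)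
    (hZ : AEMeasurable Z P) (hLZ : IndepFun (fun ω j => L j ω) Z P) (hu : 0 < u) (hη : 0 < η)
    (hη1 : η ≤ 1) :
    P {ω | η < |maxAbsInner (fun j => L j ω) (Z ω) / rexBound u p (n + 1) - 1|} ≤
      P {ω | η < |‖Z ω‖ ^ 2 / u - 1|} + (ENNReal.ofReal (2 * (p : ℝ) ^ (-η)) +
        ENNReal.ofReal (Real.exp (-(gaussianTailConst η * (p : ℝ) ^ (η ^ 2))))) := by
  let a : ℝ := (p : ℝ) ^ (-2 / n : ℝ)
  have ha0 : 0 ≤ a := by positivity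
  have ha1 : a < 1 := Real.rpow_lt_one_of_one_lt_of_neg (by exact_mod_cast hp)
    (div_neg_of_neg_of_pos (by norm_num) (by positivity))
  have hup := measure_sqrt_one_sub_rpow_mul_norm_lt_maxAbsInner_le (t := 1 + η) (by lia) hn hL hZ
    (fun j => hLZ.comp (measurable_pi_apply j) measurable_id) (by linarith)
  have hlo := measure_maxAbsInner_lt_sqrt_one_sub_rpow_mul_norm_le (by lia) hn hL hL_indep hZ hLZ
    (sub_nonneg.2 hη1) hη
  rw [show 1 - (1 + η) = -η by ring] at hup
  rw [show 1 - (1 + η) * (1 - η) = η ^ 2 by ring] at hlo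
  refine le_trans (measure_mono fun ω hω => ?_) ((measure_union_le _ _).trans
    (add_le_add_right ((measure_union_le _ _).trans (add_le_add hup hlo)) _))
  by_contra hgood
  simp only [Set.mem_union, Set.mem_ofPred_eq, not_or, not_lt] at hgood hω
  obtain ⟨hZu, hM_up, hM_lo⟩ := hgood
  have hrex : rexBound u p (n + 1) = √(u * (1 - a)) := by simp [rexBound, a]
  refine hω.not_ge (hrex ▸ abs_div_sqrt_sub_one_le (norm_nonneg _) hu (sub_pos.2 ha1) hη1 hZu
    (hM_up.trans ?_) (le_trans ?_ hM_lo))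
  · gcongr
    exact one_sub_rpow_one_add_le ha0 hη.le
  · gcongr
    exact mul_one_sub_le_one_sub_rpow_one_sub ha0 hη.le hη1

end Deviation

lemma tendsto_ofReal_rpow_neg_add_ofReal_exp_neg_rpow {c η κ : ℝ} (b : ℝ) (hc : 0 < c)
    (hη : 0 < η) (hκ : 0 < κ) :
    Tendsto (fun p : ℕ => ENNReal.ofReal (b * (p : ℝ) ^ (-η)) +
      ENNReal.ofReal (Real.exp (-(c * (p : ℝ) ^ κ)))) atTop (𝓝 0) := by
  have hpow := ((tendsto_rpow_neg_atTop hη).comp tendsto_natCast_atTop_atTop).const_mul b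
  have hexp := Real.tendsto_exp_neg_atTop_nhds_zero.comp
    (((tendsto_rpow_atTop hκ).comp tendsto_natCast_atTop_atTop).const_mul_atTop hc)
  simpa using (ENNReal.tendsto_ofReal hpow).add (ENNReal.tendsto_ofReal hexp)

lemma TendstoInProb.eventually_pos_of_div {ι : Type*} {l : Filter ι} {Ω : ι → Type*}
    [∀ i, MeasurableSpace (Ω i)] {P : ∀ i, Measure (Ω i)} {X : ∀ i, Ω i → ℝ} {u : ι → ℝ}
    (hP : ∀ᶠ i in l, IsProbabilityMeasure (P i))
    (h : TendstoInProb P (fun i ω => X i ω / u i) l 1) (hX : ∀ i ω, 0 ≤ X i ω) :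
    ∀ᶠ i in l, 0 < u i := by
  filter_upwards [hP, (h (1 / 2) (by norm_num)).eventually_lt_const one_pos] with i _ hi
  by_contra! hu
  have huniv : {ω | 1 / 2 < |X i ω / u i - 1|} = Set.univ := Set.eq_univ_of_forall fun ω => by
    have hdiv : X i ω / u i ≤ 0 := div_nonpos_of_nonneg_of_nonpos (hX i ω) hu
    have hgap : 1 / 2 < -(X i ω / u i - 1) := by linarith
    exact hgap.trans_le (neg_le_abs _)
  exact hi.ne (huniv ▸ measure_univ)

section WeakLaw

lemma tendstoInProb_pi_average {S : Type*} [MeasurableSpace S] {μ : Measure S}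
    [IsProbabilityMeasure μ] {f : S → ℝ} (hf : Measurable f) (hf_int : Integrable f μ) :
    TendstoInProb (fun d : ℕ => Measure.pi fun _ : Fin d => μ) (fun d x => (∑ i, f (x i)) / d)
      atTop (∫ s, f s ∂μ) := by
  intro δ hδ
  obtain ⟨Ω, _, P, X, hX_meas, hX, hX_indep, _⟩ := exists_iid ℕ μ
  have hident (n : ℕ) : IdentDistrib (f ∘ X n) (f ∘ X 0) P P :=
    ((hX n).identDistrib (hX 0)).comp hf
  have hint : Integrable (f ∘ X 0) P :=
    ((hX 0).measurePreserving (hX_meas 0)).integrable_comp_of_integrable hf_int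
  have hslln := strong_law_ae_real (fun n => f ∘ X n) hint
    (fun i j hij => (hX_indep.indepFun hij).comp hf hf) hident
  rw [(hX 0).integral_comp hf.aestronglyMeasurable] at hslln
  have havg := tendstoInMeasure_iff_norm.1 (tendstoInMeasure_of_tendsto_ae
    (fun d => ((Finset.measurable_fun_sum _ fun n _ => hf.comp (hX_meas n)).div_const
      (d : ℝ)).aestronglyMeasurable) hslln) δ hδ
  refine tendsto_of_tendsto_of_tendsto_of_le_of_le tendsto_const_nhds havg
    (fun _ => zero_le) fun d => ?_
  have hlaw := iIndepFun.hasLaw_pi (fun i : Fin d => hX i) (hX_indep.precomp Fin.val_injective)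
  rw [← hlaw.measure_eq (measurableSet_lt (by fun_prop) (by fun_prop))]
  refine measure_mono fun ω (hω : δ < |(∑ i : Fin d, f (X i ω)) / d - ∫ s, f s ∂μ|) => ?_
  simpa only [Set.mem_ofPred_eq, Real.norm_eq_abs, Finset.sum_range, Function.comp_apply]
    using hω.le

lemma integrable_sq_gaussianReal : Integrable (fun x : ℝ => x ^ 2) (gaussianReal 0 1) :=
  (memLp_id_gaussianReal 2).integrable_sq

lemma integral_sq_gaussianReal : ∫ x, x ^ 2 ∂(gaussianReal 0 1) = 1 := by
  have h := variance_id_gaussianReal (μ := 0) (v := 1)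
  rw [variance_of_integral_eq_zero aemeasurable_id (by simp)] at h
  simpa using h

lemma tendstoInProb_stdGaussian_sq_norm_div :
    TendstoInProb (fun d : ℕ => stdGaussian (EuclideanSpace ℝ (Fin d)))
      (fun d z => ‖z‖ ^ 2 / (d : ℝ)) atTop 1 := fun δ hδ => by
  have h := tendstoInProb_pi_average (f := fun x => x ^ 2) (by fun_prop)
    integrable_sq_gaussianReal δ hδ
  rw [integral_sq_gaussianReal] at h
  refine h.congr fun d => ?_
  rw [← (measurePreserving_toLp_stdGaussian (Fin d)).measure_preimage
    (measurableSet_lt (by fun_prop) (by fun_prop)).nullMeasurableSet]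
  simp [EuclideanSpace.real_norm_sq_eq]

end WeakLaw

theorem theorem5_general
    {Ω : ℕ → ℕ → Type*} [∀ p d, MeasurableSpace (Ω p d)]
    (P : ∀ p d, Measure (Ω p d)) [∀ p d, IsProbabilityMeasure (P p d)]
    (L : ∀ p d, Fin p → Ω p d → EuclideanSpace ℝ (Fin d))
    (Z : ∀ p d, Ω p d → EuclideanSpace ℝ (Fin d))
    (hL_unif : ∀ p d, 2 ≤ d → ∀ j, HasLaw (L p d j) (unifSphere d) (P p d))
    (hL_indep : ∀ p d, 2 ≤ d → iIndepFun (L p d) (P p d))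
    (hLZ_indep : ∀ p d, 2 ≤ d → IndepFun (fun ω j => L p d j ω) (Z p d) (P p d))
    {ν : ∀ d : ℕ, Measure (EuclideanSpace ℝ (Fin d))} {u : ℕ → ℝ}
    (hZ : ∀ p d, 2 ≤ d → HasLaw (Z p d) (ν d) (P p d)) {l : Filter ℕ} (hl : ∀ᶠ d in l, 2 ≤ d)
    (hu : TendstoInProb ν (fun d z => ‖z‖ ^ 2 / u d) l 1) :
    TendstoInProb (fun i : ℕ × ℕ => P i.1 i.2)
      (fun i ω => maxAbsInner (fun j => L i.1 i.2 j ω) (Z i.1 i.2 ω) / rexBound (u i.2) i.1 i.2)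
      (atTop ×ˢ l) 1 := by
  intro δ hδ
  let η : ℝ := min δ 1
  have hη : 0 < η := lt_min hδ one_pos
  have hbound := ((hu η hη).comp tendsto_snd).add ((tendsto_ofReal_rpow_neg_add_ofReal_exp_neg_rpow
    2 (gaussianTailConst_pos η) hη (pow_pos hη 2)).comp (tendsto_fst (f := atTop) (g := l)))
  rw [add_zero] at hbound
  refine tendsto_of_tendsto_of_tendsto_of_le_of_le' tendsto_const_nhds hbound
    (.of_forall fun _ => zero_le) ?_
  have hν : ∀ᶠ d in l, IsProbabilityMeasure (ν d) := hl.mono fun d hd =>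
    (hZ 0 d hd).isProbabilityMeasure_iff.1 inferInstance
  have hu_pos := hu.eventually_pos_of_div hν fun d z => sq_nonneg ‖z‖
  filter_upwards [tendsto_fst.eventually_ge_atTop 2, tendsto_snd.eventually hl,
    tendsto_snd.eventually hu_pos] with ⟨p, d⟩ hpi hdi hui
  obtain ⟨n, rfl⟩ : ∃ n, d = n + 1 := ⟨d - 1, by lia⟩
  have hnorm := (hZ p _ hdi).measure_eq (p := fun z => η < |‖z‖ ^ 2 / u (n + 1) - 1|)
    (measurableSet_lt (by fun_prop) (by fun_prop))
  refine (measure_mono fun ω hω => (min_le_left δ 1).trans_lt hω).trans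
    ((measure_lt_abs_maxAbsInner_div_rexBound_sub_one_le hpi (by lia) (hL_unif p _ hdi)
      (hL_indep p _ hdi) (hZ p _ hdi).aemeasurable (hLZ_indep p _ hdi) hui hη
      (min_le_right δ 1)).trans_eq ?_)
  rw [hnorm]
  rfl

theorem theorem5
    {Ω : ℕ → ℕ → Type*} [∀ p d, MeasurableSpace (Ω p d)]
    (P : ∀ p d, Measure (Ω p d)) [∀ p d, IsProbabilityMeasure (P p d)]
    (L : ∀ p d, Fin p → Ω p d → EuclideanSpace ℝ (Fin d))
    (Z : ∀ p d, Ω p d → EuclideanSpace ℝ (Fin d))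
    -- `L_1, …, L_p` are i.i.d. uniform on `S^{d-1}` and (jointly) independent of `Z`
    (hL_unif : ∀ p d, 2 ≤ d → ∀ j, HasLaw (L p d j) (unifSphere d) (P p d))
    (hL_indep : ∀ p d, 2 ≤ d → iIndepFun (L p d) (P p d))
    (hLZ_indep : ∀ p d, 2 ≤ d → IndepFun (fun ω j => L p d j ω) (Z p d) (P p d)) :
    -- elliptical case
    (∀ (ν : ∀ d : ℕ, Measure (EuclideanSpace ℝ (Fin d))) (u : ℕ → ℝ),
      (∀ d, 2 ≤ d → IsElliptical (ν d) 0 1) →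
      (∀ p d, 2 ≤ d → HasLaw (Z p d) (ν d) (P p d)) →
      TendstoInProb ν (fun d z => ‖z‖ ^ 2 / u d) atTop 1 →
      TendstoInProb (fun i : ℕ × ℕ => P i.1 i.2)
        (fun i ω => maxAbsInner (fun j => L i.1 i.2 j ω) (Z i.1 i.2 ω) / rexBound (u i.2) i.1 i.2)
        (atTop ×ˢ atTop) 1) ∧
    -- Gaussian case
    ((∀ p d, 2 ≤ d → HasLaw (Z p d) (stdGaussian (EuclideanSpace ℝ (Fin d))) (P p d)) →
      TendstoInProb (fun i : ℕ × ℕ => P i.1 i.2)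
        (fun i ω => maxAbsInner (fun j => L i.1 i.2 j ω) (Z i.1 i.2 ω) / rexBound i.2 i.1 i.2)
        (atTop ×ˢ atTop) 1) := by
  have hd : ∀ᶠ d : ℕ in atTop, 2 ≤ d := eventually_ge_atTop 2
  exact ⟨fun ν u _ hZ hu => theorem5_general P L Z hL_unif hL_indep hLZ_indep hZ hd hu,
    fun hZ => theorem5_general P L Z hL_unif hL_indep hLZ_indep hZ hd
      tendstoInProb_stdGaussian_sq_norm_div⟩
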